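/- For a finite graph $G$ let $\chi_G(n)$ denote its chromatic polynomial, i.e. the unique polynomial whose value at each $n\in\mathbb N=\{0,1,2,\dots\}$ is the number of proper colorings of the vertices of $G$ with $n$ colors. A numerical polynomial is a $g\in\mathbb Q[x]$ with $g(q)\in\mathbb Z$ for all $q\in\mathbb Z$. Let $g$ be a numerical polynomial that is eventually nonnegative, let $S=\{q\in\mathbb N: g(q)\ge 0\}$, and let $e:S\to\mathbb N\cup\{-1,\infty\}$. A two-level polynomial of degree $g$ and depth $e$ is a sequence of polynomials $\{f_q(n)\}_{q\in S}$ in $\mathbb Q[n]$, with $f_q$ of degree $g(q)$, such that, writing $f_q(n)=\sum_{r\ge 0}c_r(q)\,n^{g(q)-r}$ with $c_r(q)=0$ for $r>g(q)$, there exist polynomials $\phi_0,\phi_1,\phi_2,\dots\in\mathbb Q[x]$ with $c_r(q)=\phi_r(q)$ for every $q\in S$ and every $r\in\mathbb N$ with $r\le e(q)$; for $q\in\mathbb N\setminus S$ one sets $f_q=0$ and $e(q)=-1$. It has infinite depth if $e(q)=\infty$ for all $q\in S$. Theorem. Fix $k\in\mathbb N$, and for each $q\in\mathbb N$ let $G_q=K_q^k$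 be the Cartesian product of $k$ copies of the complete graph $K_q$ (its vertices are the $k$-tuples of elements of $\{1,\dots,q\}$, two tuples being adjacent if and only if they differ in exactly one index). Then $\{\chi_{G_q}(n)\}_{q\in\mathbb N}$ is a two-level polynomial of degree $q^k$ and infinite depth. That is, $\chi_{G_q}$ has degree $q^k$ for every $q\in\mathbb N$, and there are polynomials $\phi_r\in\mathbb Q[x]$, $r\in\mathbb N$, such that for all $q,r\in\mathbb N$ the number $\phi_r(q)$ is the coefficient of $n^{q^k-r}$ in $\chi_{G_q}(n)$ if $r\le q^k$, and is $0$ if $r>q^k$. -/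

import Mathlib

open Polynomial

/-! ### Numerical polynomials and two-level polynomials -/

/-- A numerical polynomial: a polynomial with rational coefficients that takes integer values
at all integers. -/
def IsNumericalPolynomial (g : ℚ[X]) : Prop :=
  ∀ q : ℤ, ∃ m : ℤ, g.eval (q : ℚ) = (m : ℚ)

/-- The codegree `r` coefficient of `p`: the coefficient of degree `deg p - r`, which is `0` by
convention when `r > deg p`. -/
noncomputable def codegreeCoeff (p : ℚ[X]) (r : ℕ) : ℚ :=
  if r ≤ p.natDegree then p.coeff (p.natDegree - r) else 0

/-- The sequence `f` of polynomials is a two-level polynomial of degree `g` and depth `e`.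
With `S = {q ∈ ℕ : g q ≥ 0}`, the polynomial `f q` has degree exactly `g q` for all `q ∈ S`, and
there are polynomials `φ r` such that for all `q ∈ S` and all `r ≤ e q` the codegree `r`
coefficient of `f q` equals `φ r` evaluated at `q`. Off `S`, `f q = 0` and `e q = -1`.
Depths live in `ℕ ∪ {-1, ∞}`, which is `WithBot ℕ∞` with `⊥` for `-1` and `⊤` for `∞`. -/
structure IsTwoLevelPolynomial (g : ℚ[X]) (e : ℕ → WithBot ℕ∞) (f : ℕ → ℚ[X]) : Prop where
  numerical : IsNumericalPolynomial g
  eventually_nonneg : ∀ᶠ q : ℕ in Filter.atTop, 0 ≤ g.eval (q : ℚ)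
  degree_eq : ∀ q : ℕ, 0 ≤ g.eval (q : ℚ) →
    f q ≠ 0 ∧ ((f q).natDegree : ℚ) = g.eval (q : ℚ)
  exists_coeff : ∃ φ : ℕ → ℚ[X], ∀ q : ℕ, 0 ≤ g.eval (q : ℚ) →
    ∀ r : ℕ, ((r : ℕ∞) : WithBot ℕ∞) ≤ e q → codegreeCoeff (f q) r = (φ r).eval (q : ℚ)
  eq_zero : ∀ q : ℕ, g.eval (q : ℚ) < 0 → f q = 0 ∧ e q = ⊥

/-! ### Chromatic polynomials -/

/-- `p` takes at each natural number `n` the number of proper colorings of `G` with `n` colors. -/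
def IsChromaticPolynomial {V : Type*} (G : SimpleGraph V) (p : ℚ[X]) : Prop :=
  ∀ n : ℕ, p.eval (n : ℚ) = (Nat.card (G.Coloring (Fin n)) : ℚ)

theorem IsChromaticPolynomial.unique {V : Type*} {G : SimpleGraph V} {p p' : ℚ[X]}
    (h : IsChromaticPolynomial G p) (h' : IsChromaticPolynomial G p') : p = p' := by
  refine Polynomial.eq_of_infinite_eval_eq p p' ?_
  refine (Set.infinite_range_of_injective (Nat.cast_injective (R := ℚ))).mono ?_
  rintro _ ⟨n, rfl⟩
  exact (h n).trans (h' n).symm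

/-- The number of maps `V → Fin n` whose fibres form exactly the partition `s`. -/
theorem card_ker_eq {V : Type*} [Finite V] (s : Setoid V) (n : ℕ) :
    Nat.card {f : V → Fin n // Setoid.ker f = s}
      = n.descFactorial (Nat.card (Quotient s)) := by
  classical
  have : Fintype (Quotient s) := Fintype.ofFinite _
  have e : {f : V → Fin n // Setoid.ker f = s} ≃ (Quotient s ↪ Fin n) :=
    { toFun := fun f => ⟨Quotient.lift f.1 (fun a b hab => by
          have : (Setoid.ker f.1) a b := by rw [f.2]; exact hab
          exact this), by
        rintro ⟨a⟩ ⟨b⟩ hab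
        refine Quotient.sound ?_
        have : (Setoid.ker f.1) a b := hab
        rw [f.2] at this
        exact this⟩
      invFun := fun c => ⟨fun v => c (Quotient.mk s v), by
        ext a b
        rw [Setoid.ker_def, c.injective.eq_iff]
        exact Quotient.eq⟩
      left_inv := fun f => by ext v; rfl
      right_inv := fun c => by ext ⟨v⟩; rfl }
  rw [Nat.card_congr e, Nat.card_eq_fintype_card, Fintype.card_embedding_eq, Fintype.card_fin,
    Nat.card_eq_fintype_card]

theorem exists_isChromaticPolynomial {V : Type*} [Finite V] (G : SimpleGraph V) :
    ∃ p : ℚ[X], IsChromaticPolynomial G p := by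
  classical
  have : Fintype V := Fintype.ofFinite V
  have : Finite (Setoid V) := Finite.of_injective (fun s : Setoid V => (fun a b => s a b))
    (fun s t h => Setoid.ext fun a b => iff_of_eq (congrFun (congrFun h a) b))
  let I := {s : Setoid V // ∀ a b, G.Adj a b → ¬ s a b}
  have : Fintype I := Fintype.ofFinite I
  refine ⟨∑ s : I, descPochhammer ℚ (Nat.card (Quotient s.1)), fun n => ?_⟩
  have e : G.Coloring (Fin n) ≃ Σ s : I, {f : V → Fin n // Setoid.ker f = s.1} :=
    { toFun := fun c => ⟨⟨Setoid.ker c, fun a b hab h => c.valid hab h⟩, ⟨c, rfl⟩⟩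
      invFun := fun x => SimpleGraph.Coloring.mk x.2.1 (fun {a b} hab h =>
        x.1.2 a b hab (by rw [← x.2.2]; exact h))
      left_inv := fun c => by ext v; rfl
      right_inv := by rintro ⟨⟨s, hs⟩, ⟨f, h⟩⟩; change Setoid.ker f = s at h; subst h; rfl }
  rw [Nat.card_congr e, Nat.card_sigma]
  simp only [card_ker_eq, eval_finsetSum, descPochhammer_eval_eq_descFactorial, Nat.cast_sum]

/-- The chromatic polynomial of a finite graph: the unique polynomial whose value at each natural
number `n` is the number of proper colorings of `G` with `n` colors. -/
noncomputable def chromaticPolynomial {V : Type*} [Finite V] (G : SimpleGraph V) : ℚ[X] :=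
  Classical.choose (exists_isChromaticPolynomial G)

theorem isChromaticPolynomial_chromaticPolynomial {V : Type*} [Finite V] (G : SimpleGraph V) :
    IsChromaticPolynomial G (chromaticPolynomial G) :=
  Classical.choose_spec (exists_isChromaticPolynomial G)

/-! ### Cartesian powers -/

/-- The Cartesian product of `k` copies of `G`: the vertices are the `k`-tuples of vertices of `G`,
two of them being adjacent when they are adjacent in `G` at one index and agree at all others. -/
def SimpleGraph.cartesianPower {V : Type*} (G : SimpleGraph V) (k : ℕ) :
    SimpleGraph (Fin k → V) where
  Adj u v := ∃ i : Fin k, G.Adj (u i) (v i) ∧ ∀ j : Fin k, j ≠ i → u j = v j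
  symm := ⟨fun _ _ ⟨i, hi, hj⟩ => ⟨i, hi.symm, fun j h => (hj j h).symm⟩⟩
  loopless := ⟨fun _ ⟨_, hi, _⟩ => G.irrefl hi⟩

/-!
By inclusion–exclusion over the monochromatic edges (Whitney), the coefficient of `n ^ (|V| - r)` in
the chromatic polynomial of `G` is the sum of `(-1) ^ |E(H)|` over the spanning subgraphs `H ≤ G` of
rank `r`, the rank being `|V|` minus the number of components. A subgraph of rank `r` has at most
`2 r` non-isolated vertices, so if the vertices are `k`-tuples over `Fin q`, then at most `2 r k`
elements of `Fin q` occur as entries of these. If adjacency is invariant under injective renaming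
of entries, then the contribution of the subgraphs whose set of entries is `S` only depends on
`s = |S|`. The coefficient is therefore a combination of the binomial coefficients
`q.choose s` with `s ≤ 2 r k`, whose weights do not depend on `q`, hence a polynomial in `q`.
-/

section Monochromatic

variable {V W β : Type*}

/-- The graph joining distinct vertices on which `f` takes the same value. A colouring `f` of `G` is
proper exactly when `G` is disjoint from this graph, and `f` is constant on the connected components
of `H` exactly when `H` lies below it. -/
def monochromaticGraph (f : V → β) : SimpleGraph V :=
  ((SimpleGraph.completeGraph β).comap f)ᶜ

theorem monochromaticGraph_adj {f : V → β} {u v : V} :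
    (monochromaticGraph f).Adj u v ↔ u ≠ v ∧ f u = f v := by
  simp [monochromaticGraph]

theorem disjoint_monochromaticGraph_iff {G : SimpleGraph V} {f : V → β} :
    Disjoint G (monochromaticGraph f) ↔ ∀ u v, G.Adj u v → f u ≠ f v :=
  disjoint_compl_right_iff

theorem le_monochromaticGraph_iff {H : SimpleGraph V} {f : V → β} :
    H ≤ monochromaticGraph f ↔ ∀ u v, H.Adj u v → f u = f v :=
  forall₂_congr fun _ _ => ⟨fun h hadj => (monochromaticGraph_adj.1 (h hadj)).2,
    fun h hadj => monochromaticGraph_adj.2 ⟨hadj.ne, h hadj⟩⟩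

theorem comap_monochromaticGraph (φ : V ↪ W) (f : W → β) :
    (monochromaticGraph f).comap φ = monochromaticGraph (f ∘ φ) := by
  ext u v
  simp only [SimpleGraph.comap_adj, monochromaticGraph_adj, φ.injective.ne_iff,
    Function.comp_apply]

theorem eq_of_reachable_of_le_monochromaticGraph {H : SimpleGraph V} {f : V → β}
    (hf : H ≤ monochromaticGraph f) {u v : V} (huv : H.Reachable u v) : f u = f v := by
  obtain ⟨p⟩ := huv
  induction p with
  | nil => rfl
  | cons hadj _ ih => exact (le_monochromaticGraph_iff.1 hf _ _ hadj).trans ih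

/-- Colourings that are constant along the edges of `H` are colourings of its components. -/
def monochromaticEquiv (H : SimpleGraph V) (β : Type*) :
    {f : V → β // H ≤ monochromaticGraph f} ≃ (H.ConnectedComponent → β) where
  toFun f := SimpleGraph.ConnectedComponent.lift f.1 fun _ _ p _ =>
    eq_of_reachable_of_le_monochromaticGraph f.2 p.reachable
  invFun g := ⟨g ∘ H.connectedComponentMk, le_monochromaticGraph_iff.2 fun _ _ hadj =>
    congrArg g (SimpleGraph.ConnectedComponent.sound hadj.reachable)⟩
  left_inv _ := rfl
  right_inv _ := funext <| SimpleGraph.ConnectedComponent.ind fun _ => rfl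

theorem card_le_monochromaticGraph [Finite V] (H : SimpleGraph V) (β : Type*) :
    Nat.card {f : V → β // H ≤ monochromaticGraph f} =
      Nat.card β ^ Nat.card H.ConnectedComponent := by
  rw [Nat.card_congr (monochromaticEquiv H β), Nat.card_fun]

open scoped Classical in
/-- A colouring that is constant along the edges of `H.map φ` consists of such a colouring for `H`
and an arbitrary colouring outside the range of `φ`. -/
noncomputable def monochromaticMapEquiv (φ : V ↪ W) (H : SimpleGraph V) (β : Type*) :
    {f : W → β // H.map φ ≤ monochromaticGraph f} ≃
      {f : V → β // H ≤ monochromaticGraph f} × ({w // w ∉ Set.range φ} → β) :=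
  ((Equiv.piEquivPiSubtypeProd (· ∈ Set.range φ) fun _ => β).trans
    (Equiv.prodCongrLeft fun _ =>
      (Equiv.ofInjective φ φ.injective).symm.arrowCongr (Equiv.refl β))).subtypeEquiv
    (q := fun f => H ≤ monochromaticGraph f.1)
    (fun f => by rw [SimpleGraph.map_le_iff_le_comap, comap_monochromaticGraph]; rfl)
  |>.trans (Equiv.prodSubtypeFstEquivSubtypeProd (p := fun f : V → β => H ≤ monochromaticGraph f))

end Monochromatic

section Rank

variable {V W : Type*}

/-- The rank of a finite graph in the sense of matroid theory: the number of its vertices minus the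
number of its connected components. -/
noncomputable def graphRank (H : SimpleGraph V) : ℕ :=
  Nat.card V - Nat.card H.ConnectedComponent

theorem card_connectedComponent_add_graphRank [Finite V] (H : SimpleGraph V) :
    Nat.card H.ConnectedComponent + graphRank H = Nat.card V :=
  Nat.add_sub_of_le (Nat.card_le_card_of_surjective H.connectedComponentMk Quot.mk_surjective)

theorem graphRank_bot [Finite V] : graphRank (⊥ : SimpleGraph V) = 0 := by
  have hinj : Function.Injective (⊥ : SimpleGraph V).connectedComponentMk := fun u v huv =>
    SimpleGraph.reachable_bot.1 (SimpleGraph.ConnectedComponent.exact huv)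
  exact Nat.sub_eq_zero_of_le (Nat.card_le_card_of_injective _ hinj)

theorem graphRank_map [Finite V] [Finite W] (φ : V ↪ W) (H : SimpleGraph V) :
    graphRank (H.map φ) = graphRank H := by
  -- The number of components can be read off from the number of two-colourings constant on them.
  have hcomponents : Nat.card (H.map φ).ConnectedComponent =
      Nat.card H.ConnectedComponent + Nat.card {w // w ∉ Set.range φ} := by
    have hcard := Nat.card_congr (monochromaticMapEquiv φ H (Fin 2))
    rw [Nat.card_prod, card_le_monochromaticGraph, card_le_monochromaticGraph, Nat.card_fun,
      Nat.card_fin, ← pow_add] at hcard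
    exact Nat.pow_right_injective le_rfl hcard
  have hvertices : Nat.card V + Nat.card {w // w ∉ Set.range φ} = Nat.card W := by
    classical
    rw [Nat.card_congr (Equiv.ofInjective φ φ.injective), ← Nat.card_sum,
      Nat.card_congr (Equiv.sumCompl (· ∈ Set.range φ))]
  rw [graphRank, graphRank, hcomponents, ← hvertices, Nat.add_sub_add_right]

/-- Fix one representative in each component. Choosing neighbours maps the non-isolated
representatives injectively to non-representatives, whose number is the rank. -/
theorem ncard_support_le_two_mul_graphRank [Finite V] (H : SimpleGraph V) :
    H.support.ncard ≤ 2 * graphRank H := by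
  set reps : Set V := Set.range (Quot.out : H.ConnectedComponent → V)
  have eq_of_reachable {u v : V} (hu : u ∈ reps) (hv : v ∈ reps) (huv : H.Reachable u v) :
      u = v := by
    obtain ⟨c, rfl⟩ := hu
    obtain ⟨d, rfl⟩ := hv
    have hcd := SimpleGraph.ConnectedComponent.sound huv
    rw [show c = d from (Quot.out_eq c).symm.trans (hcd.trans (Quot.out_eq d))]
  have ncard_compl_reps : repsᶜ.ncard = graphRank H := by
    rw [Set.ncard_compl, Set.ncard_range_of_injective (Function.LeftInverse.injective Quot.out_eq)]
    rfl
  choose! neighbor adj_neighbor using fun v (hv : v ∈ H.support) => H.mem_support.1 hv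
  have ncard_support_inter_reps : (H.support ∩ reps).ncard ≤ repsᶜ.ncard := by
    refine Set.ncard_le_ncard_of_injOn neighbor (fun v hv hmem => ?_) fun u hu v hv huv => ?_
    · have hadj := adj_neighbor v hv.1
      exact hadj.ne (eq_of_reachable hv.2 hmem hadj.reachable)
    · refine eq_of_reachable hu.2 hv.2 ((adj_neighbor u hu.1).reachable.trans ?_)
      rw [huv]
      exact (adj_neighbor v hv.1).reachable.symm
  calc H.support.ncard
      = (H.support ∩ reps).ncard + (H.support \ reps).ncard :=
        (Set.ncard_inter_add_ncard_sdiff_eq_ncard _ _).symm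
    _ ≤ repsᶜ.ncard + repsᶜ.ncard :=
        add_le_add ncard_support_inter_reps (Set.ncard_le_ncard fun _ hv => hv.2)
    _ = 2 * graphRank H := by rw [ncard_compl_reps, two_mul]

theorem graphRank_eq_zero_iff [Finite V] {H : SimpleGraph V} : graphRank H = 0 ↔ H = ⊥ := by
  refine ⟨fun hrank => ?_, fun h => h ▸ graphRank_bot⟩
  have hsupport := ncard_support_le_two_mul_graphRank H
  rw [hrank, mul_zero, nonpos_iff_eq_zero, Set.ncard_eq_zero] at hsupport
  exact H.support_eq_bot_iff.1 hsupport

theorem graphRank_le_card (H : SimpleGraph V) : graphRank H ≤ Nat.card V :=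
  Nat.sub_le _ _

end Rank

section Whitney

variable {V : Type*}

open scoped Classical in
theorem sum_neg_one_pow_ncard_edgeSet [Fintype V] (R : Type*) [Ring R] (G : SimpleGraph V) :
    ∑ H : SimpleGraph V with H ≤ G, (-1 : R) ^ H.edgeSet.ncard = if G = ⊥ then 1 else 0 := by
  have hpowerset : ∑ H : SimpleGraph V with H ≤ G, (-1 : ℤ) ^ H.edgeSet.ncard =
      ∑ A ∈ G.edgeFinset.powerset, (-1) ^ A.card := by
    refine Finset.sum_bij (fun H _ => H.edgeFinset) (fun H hH => ?_) (fun _ _ _ _ => ?_)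
      (fun A hA => ?_) fun H _ => ?_
    · simpa using hH
    · exact SimpleGraph.edgeFinset_inj.1
    · have hA' : (A : Set (Sym2 V)) ⊆ G.edgeSet := by
        rwa [← SimpleGraph.coe_edgeFinset, Finset.coe_subset, ← Finset.mem_powerset]
      have hedge : (SimpleGraph.fromEdgeSet (A : Set (Sym2 V))).edgeSet = A := by
        rw [SimpleGraph.edgeSet_fromEdgeSet, sdiff_eq_left, Set.disjoint_left]
        exact fun e he => G.not_isDiag_of_mem_edgeSet (hA' he)
      refine ⟨SimpleGraph.fromEdgeSet A, ?_, ?_⟩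
      · rwa [Finset.mem_filter_univ, ← SimpleGraph.edgeSet_subset_edgeSet, hedge]
      · rw [← Finset.coe_inj, SimpleGraph.coe_edgeFinset, hedge]
    · rw [← SimpleGraph.coe_edgeFinset, Set.ncard_coe_finset]
  rw [Finset.sum_powerset_neg_one_pow_card] at hpowerset
  simpa using congrArg (Int.cast : ℤ → R) hpowerset

open scoped Classical in
theorem card_coloring_eq_sum [Fintype V] (G : SimpleGraph V) (n : ℕ) :
    (Nat.card (G.Coloring (Fin n)) : ℚ) =
      ∑ f : V → Fin n, if G ⊓ monochromaticGraph f = ⊥ then 1 else 0 := by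
  have hcoloring : G.Coloring (Fin n) ≃ {f : V → Fin n // G ⊓ monochromaticGraph f = ⊥} :=
    { toFun c := ⟨c, disjoint_iff.1 (disjoint_monochromaticGraph_iff.2 fun _ _ => c.valid)⟩
      invFun f := SimpleGraph.Coloring.mk f.1 fun {u v} =>
        disjoint_monochromaticGraph_iff.1 (disjoint_iff.2 f.2) u v
      left_inv _ := rfl
      right_inv _ := rfl }
  rw [Nat.card_congr hcoloring, Finset.sum_boole, Nat.card_eq_fintype_card, Fintype.card_subtype]

open scoped Classical in
theorem chromaticPolynomial_eq_sum [Fintype V] (G : SimpleGraph V) :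
    chromaticPolynomial G = ∑ H : SimpleGraph V with H ≤ G,
      C ((-1) ^ H.edgeSet.ncard) * X ^ Nat.card H.ConnectedComponent := by
  refine (isChromaticPolynomial_chromaticPolynomial G).unique fun n => ?_
  have hcount (H : SimpleGraph V) : (n : ℚ) ^ Nat.card H.ConnectedComponent =
      ∑ f : V → Fin n, if H ≤ monochromaticGraph f then 1 else 0 := by
    have hcard := card_le_monochromaticGraph H (Fin n)
    rw [Nat.card_fin, Nat.card_eq_fintype_card, Fintype.card_subtype] at hcard
    rw [Finset.sum_boole, hcard, Nat.cast_pow]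
  calc (∑ H : SimpleGraph V with H ≤ G,
        C ((-1 : ℚ) ^ H.edgeSet.ncard) * X ^ Nat.card H.ConnectedComponent).eval (n : ℚ)
      = ∑ H : SimpleGraph V with H ≤ G, ∑ f : V → Fin n,
          if H ≤ monochromaticGraph f then (-1 : ℚ) ^ H.edgeSet.ncard else 0 := by
        simp only [eval_finsetSum, eval_mul, eval_C, eval_pow, eval_X, hcount, Finset.mul_sum,
          mul_ite, mul_one, mul_zero]
    _ = ∑ f : V → Fin n, ∑ H : SimpleGraph V with H ≤ G ⊓ monochromaticGraph f,
          (-1) ^ H.edgeSet.ncard := by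
        rw [Finset.sum_comm]
        simp only [← Finset.sum_filter, Finset.filter_filter, le_inf_iff]
    _ = Nat.card (G.Coloring (Fin n)) := by
        simp only [sum_neg_one_pow_ncard_edgeSet, card_coloring_eq_sum]

open scoped Classical in
/-- The signed Whitney number of the first kind, counting the spanning subgraphs of rank `r` by the
parity of their number of edges. -/
noncomputable def whitneyNumber [Fintype V] (G : SimpleGraph V) (r : ℕ) : ℚ :=
  ∑ H : SimpleGraph V with H ≤ G ∧ graphRank H = r, (-1) ^ H.edgeSet.ncard

theorem whitneyNumber_zero [Fintype V] (G : SimpleGraph V) : whitneyNumber G 0 = 1 := by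
  classical
  refine (Finset.sum_eq_single_of_mem ⊥ (by simp [graphRank_bot]) fun H hH hne => ?_).trans
    (by simp)
  exact absurd (graphRank_eq_zero_iff.1 (Finset.mem_filter.1 hH).2.2) hne

theorem whitneyNumber_eq_zero_of_card_lt [Fintype V] (G : SimpleGraph V) {r : ℕ}
    (hr : Nat.card V < r) : whitneyNumber G r = 0 := by
  classical
  refine Finset.sum_eq_zero fun H hH => absurd (graphRank_le_card H) (not_le.2 ?_)
  rwa [(Finset.mem_filter.1 hH).2.2]

theorem coeff_chromaticPolynomial_card_sub [Fintype V] (G : SimpleGraph V) {r : ℕ}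
    (hr : r ≤ Nat.card V) :
    (chromaticPolynomial G).coeff (Nat.card V - r) = whitneyNumber G r := by
  classical
  have hrank (H : SimpleGraph V) :
      Nat.card V - r = Nat.card H.ConnectedComponent ↔ graphRank H = r := by
    have := card_connectedComponent_add_graphRank H
    omega
  simp only [chromaticPolynomial_eq_sum, finsetSum_coeff, coeff_C_mul_X_pow, hrank,
    ← Finset.sum_filter, Finset.filter_filter, whitneyNumber]

theorem natDegree_chromaticPolynomial_le [Finite V] (G : SimpleGraph V) :
    (chromaticPolynomial G).natDegree ≤ Nat.card V := by
  classical
  have := Fintype.ofFinite V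
  rw [chromaticPolynomial_eq_sum]
  refine natDegree_sum_le_of_forall_le _ _ fun H _ => (natDegree_C_mul_X_pow_le _ _).trans ?_
  exact (Nat.le_add_right _ _).trans_eq (card_connectedComponent_add_graphRank H)

theorem coeff_chromaticPolynomial_card [Finite V] (G : SimpleGraph V) :
    (chromaticPolynomial G).coeff (Nat.card V) = 1 := by
  have := Fintype.ofFinite V
  exact (coeff_chromaticPolynomial_card_sub G (Nat.zero_le _)).trans (whitneyNumber_zero G)

theorem monic_chromaticPolynomial [Finite V] (G : SimpleGraph V) : (chromaticPolynomial G).Monic :=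
  monic_of_natDegree_le_of_coeff_eq_one _ (natDegree_chromaticPolynomial_le G)
    (coeff_chromaticPolynomial_card G)

theorem natDegree_chromaticPolynomial [Finite V] (G : SimpleGraph V) :
    (chromaticPolynomial G).natDegree = Nat.card V :=
  natDegree_eq_of_le_of_coeff_ne_zero (natDegree_chromaticPolynomial_le G)
    (coeff_chromaticPolynomial_card G ▸ one_ne_zero)

theorem codegreeCoeff_chromaticPolynomial [Fintype V] (G : SimpleGraph V) (r : ℕ) :
    codegreeCoeff (chromaticPolynomial G) r = whitneyNumber G r := by
  rw [codegreeCoeff, natDegree_chromaticPolynomial]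
  split_ifs with hr
  · exact coeff_chromaticPolynomial_card_sub G hr
  · exact (whitneyNumber_eq_zero_of_card_lt G (not_le.1 hr)).symm

end Whitney

section EntrySupport

variable {ι α β : Type*}

/-- The finite set of those elements of `α` that occur as an entry of a non-isolated vertex of a
graph on the tuples `ι → α`. -/
noncomputable def entrySupport [Finite α] (H : SimpleGraph (ι → α)) : Finset α :=
  (Set.toFinite (⋃ v ∈ H.support, Set.range v)).toFinset

theorem mem_entrySupport [Finite α] {H : SimpleGraph (ι → α)} {x : α} :
    x ∈ entrySupport H ↔ ∃ v ∈ H.support, ∃ i, v i = x := by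
  simp [entrySupport]

theorem entrySupport_map [Finite α] [Finite β] (φ : α ↪ β) (H : SimpleGraph (ι → α)) :
    entrySupport (H.map φ.arrowCongrRight) = (entrySupport H).map φ := by
  ext x
  simp [mem_entrySupport, SimpleGraph.support_map]

theorem card_entrySupport_le [Finite ι] [Finite α] (H : SimpleGraph (ι → α)) :
    (entrySupport H).card ≤ 2 * graphRank H * Nat.card ι := by
  classical
  have := Fintype.ofFinite ι
  have := Fintype.ofFinite α
  have hunion : entrySupport H = H.support.toFinset.biUnion fun v => Finset.univ.image v := by
    ext x
    simp [mem_entrySupport]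
  calc (entrySupport H).card
      ≤ H.support.toFinset.card * Nat.card ι := by
        rw [hunion, Nat.card_eq_fintype_card]
        exact Finset.card_biUnion_le_card_mul _ _ _ fun v _ => Finset.card_image_le
    _ = H.support.ncard * Nat.card ι := by rw [Set.ncard_eq_toFinset_card']
    _ ≤ 2 * graphRank H * Nat.card ι := by gcongr; exact ncard_support_le_two_mul_graphRank H

theorem map_comap_arrowCongrRight_of_entrySupport_subset [Finite β] (φ : α ↪ β)
    {H : SimpleGraph (ι → β)} (hH : ∀ x ∈ entrySupport H, x ∈ Set.range φ) :
    (H.comap φ.arrowCongrRight).map φ.arrowCongrRight = H := by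
  have mem_range {v : ι → β} (hv : v ∈ H.support) : v ∈ Set.range φ.arrowCongrRight := by
    choose u hu using fun i => hH (v i) (mem_entrySupport.2 ⟨v, hv, i, rfl⟩)
    exact ⟨u, funext hu⟩
  refine le_antisymm (SimpleGraph.map_comap_le _ H) fun v w hvw => ?_
  obtain ⟨v, rfl⟩ := mem_range ⟨w, hvw⟩
  obtain ⟨w, rfl⟩ := mem_range ⟨_, hvw.symm⟩
  exact SimpleGraph.map_adj_apply.2 hvw

open scoped Classical in
/-- The part of the Whitney number of a graph on tuples that is contributed by the spanning
subgraphs with entry support `S`. -/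
noncomputable def whitneyNumberOn [Fintype ι] [Fintype α] (G : SimpleGraph (ι → α)) (r : ℕ)
    (S : Finset α) : ℚ :=
  ∑ H : SimpleGraph (ι → α) with H ≤ G ∧ graphRank H = r ∧ entrySupport H = S,
    (-1) ^ H.edgeSet.ncard

open scoped Classical in
theorem whitneyNumber_eq_sum_whitneyNumberOn [Fintype ι] [Fintype α] (G : SimpleGraph (ι → α))
    (r : ℕ) : whitneyNumber G r = ∑ S : Finset α, whitneyNumberOn G r S := by
  rw [whitneyNumber, ← Finset.sum_fiberwise _ entrySupport]
  simp only [whitneyNumberOn, Finset.filter_filter, and_assoc]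
  congr!

theorem whitneyNumberOn_eq_zero [Fintype ι] [Fintype α] (G : SimpleGraph (ι → α)) {r : ℕ}
    {S : Finset α} (hS : 2 * r * Nat.card ι < S.card) : whitneyNumberOn G r S = 0 := by
  classical
  refine Finset.sum_eq_zero fun H hH => absurd (card_entrySupport_le H) (not_le.2 ?_)
  obtain ⟨-, rfl, rfl⟩ := (Finset.mem_filter.1 hH).2
  exact hS

theorem whitneyNumberOn_map [Fintype ι] [Fintype α] [Fintype β] (φ : α ↪ β)
    (G : SimpleGraph (ι → β)) (r : ℕ) (S : Finset α) :
    whitneyNumberOn G r (S.map φ) = whitneyNumberOn (G.comap φ.arrowCongrRight) r S := by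
  classical
  set Φ : (ι → α) ↪ (ι → β) := φ.arrowCongrRight
  symm
  have hiff (H : SimpleGraph (ι → α)) :
      (H.map Φ ≤ G ∧ graphRank (H.map Φ) = r ∧ entrySupport (H.map Φ) = S.map φ) ↔
        H ≤ G.comap Φ ∧ graphRank H = r ∧ entrySupport H = S := by
    rw [SimpleGraph.map_le_iff_le_comap, graphRank_map, entrySupport_map, Finset.map_inj]
  refine Finset.sum_bij (fun H _ => H.map Φ) (fun H hH => ?_)
    (fun H _ K _ hHK => SimpleGraph.map_injective Φ hHK) (fun H hH => ?_) fun H _ => ?_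
  · simpa only [Finset.mem_filter_univ, hiff] using hH
  · rw [Finset.mem_filter_univ] at hH
    have hmap : (H.comap Φ).map Φ = H := by
      refine map_comap_arrowCongrRight_of_entrySupport_subset φ fun x hx => ?_
      rw [hH.2.2] at hx
      obtain ⟨y, -, rfl⟩ := Finset.mem_map.1 hx
      exact ⟨y, rfl⟩
    refine ⟨H.comap Φ, ?_, hmap⟩
    rwa [Finset.mem_filter_univ, ← hiff, hmap]
  · rw [SimpleGraph.edgeSet_map, Set.ncard_image_of_injective _ Φ.sym2Map.injective]

end EntrySupport

theorem exists_polynomial_eval_eq_sum_card {K : Type*} [Field K] [CharZero K] (w : ℕ → K) {d : ℕ}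
    (hw : ∀ s, d ≤ s → w s = 0) :
    ∃ P : K[X], ∀ q : ℕ, ∑ S : Finset (Fin q), w S.card = P.eval (q : K) := by
  refine ⟨∑ s ∈ Finset.range d, C (w s / s.factorial) * descPochhammer K s, fun q => ?_⟩
  calc ∑ S : Finset (Fin q), w S.card
      = ∑ s ∈ Finset.range (q + 1), (q.choose s : K) * w s := by
        rw [← Finset.powerset_univ, Finset.sum_powerset_apply_card, Finset.card_fin]
        simp only [nsmul_eq_mul]
    _ = ∑ s ∈ Finset.range (q + 1 + d), (q.choose s : K) * w s := by
        refine (Finset.eventually_constant_sum (fun s hs => ?_) (Nat.le_add_right _ _)).symm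
        rw [Nat.choose_eq_zero_of_lt hs, Nat.cast_zero, zero_mul]
    _ = ∑ s ∈ Finset.range d, (q.choose s : K) * w s :=
        Finset.eventually_constant_sum (fun s hs => by rw [hw s hs, mul_zero])
          (Nat.le_add_left _ _)
    _ = (∑ s ∈ Finset.range d, C (w s / s.factorial) * descPochhammer K s).eval (q : K) := by
        rw [eval_finsetSum]
        refine Finset.sum_congr rfl fun s _ => ?_
        rw [eval_mul, eval_C, Nat.cast_choose_eq_descPochhammer_div]
        ring

section TwoLevel

variable {ι : Type*}

/-- A family of graphs on the tuples over `Fin q`, for all `q`, in which adjacency of two tuples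
only depends on the coincidences among their entries, so that it is not affected by an injective
renaming of the entries. -/
def IsEmbeddingInvariant (G : ∀ q, SimpleGraph (ι → Fin q)) : Prop :=
  ∀ ⦃p q : ℕ⦄ (φ : Fin p ↪ Fin q), (G q).comap φ.arrowCongrRight = G p

theorem IsEmbeddingInvariant.whitneyNumberOn_eq [Fintype ι] {G : ∀ q, SimpleGraph (ι → Fin q)}
    (hG : IsEmbeddingInvariant G) (r : ℕ) {q : ℕ} (S : Finset (Fin q)) :
    whitneyNumberOn (G q) r S = whitneyNumberOn (G S.card) r Finset.univ := by
  rw [← hG (S.orderEmbOfFin rfl).toEmbedding, ← whitneyNumberOn_map,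
    Finset.map_orderEmbOfFin_univ]

open scoped Classical in
theorem IsEmbeddingInvariant.exists_polynomial_eval_eq_whitneyNumber [Fintype ι]
    {G : ∀ q, SimpleGraph (ι → Fin q)} (hG : IsEmbeddingInvariant G) (r : ℕ) :
    ∃ φ : ℚ[X], ∀ q : ℕ, whitneyNumber (G q) r = φ.eval (q : ℚ) := by
  obtain ⟨φ, hφ⟩ := exists_polynomial_eval_eq_sum_card
    (fun s => whitneyNumberOn (G s) r Finset.univ) (d := 2 * r * Nat.card ι + 1)
    fun s hs => whitneyNumberOn_eq_zero _ (by rwa [Finset.card_fin])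
  refine ⟨φ, fun q => ?_⟩
  rw [whitneyNumber_eq_sum_whitneyNumberOn, ← hφ]
  exact Finset.sum_congr rfl fun S _ => hG.whitneyNumberOn_eq r S

theorem mainTheorem3_general [Finite ι] {G : ∀ q, SimpleGraph (ι → Fin q)}
    (hG : IsEmbeddingInvariant G) :
    IsTwoLevelPolynomial ((X : ℚ[X]) ^ Nat.card ι) (fun _ => ⊤)
      (fun q => chromaticPolynomial (G q)) := by
  classical
  have := Fintype.ofFinite ι
  choose φ hφ using hG.exists_polynomial_eval_eq_whitneyNumber
  have eval_nonneg (q : ℕ) : 0 ≤ ((X : ℚ[X]) ^ Nat.card ι).eval (q : ℚ) := by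
    rw [eval_pow, eval_X]
    positivity
  exact
    { numerical q := ⟨q ^ Nat.card ι, by simp⟩
      eventually_nonneg := .of_forall eval_nonneg
      degree_eq q _ := ⟨(monic_chromaticPolynomial (G q)).ne_zero, by
        simp [natDegree_chromaticPolynomial]⟩
      exists_coeff := ⟨φ, fun q _ r _ =>
        (codegreeCoeff_chromaticPolynomial (G q) r).trans (hφ r q)⟩
      eq_zero q hq := absurd hq (eval_nonneg q).not_gt }

end TwoLevel

theorem comap_cartesianPower {V W : Type*} (φ : V ↪ W) (G : SimpleGraph W) (k : ℕ) :
    (G.cartesianPower k).comap φ.arrowCongrRight = (G.comap φ).cartesianPower k := by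
  ext u v
  simp [SimpleGraph.cartesianPower, φ.injective.eq_iff]

theorem isEmbeddingInvariant_cartesianPower_completeGraph (k : ℕ) :
    IsEmbeddingInvariant fun q => (SimpleGraph.completeGraph (Fin q)).cartesianPower k :=
  fun _ _ φ => by rw [comap_cartesianPower, SimpleGraph.comap_top φ.injective]

theorem mainTheorem3 (k : ℕ) :
    IsTwoLevelPolynomial ((X : ℚ[X]) ^ k) (fun _ => ⊤)
      (fun q => chromaticPolynomial ((SimpleGraph.completeGraph (Fin q)).cartesianPower k)) := by
  simpa only [Nat.card_fin] using
    mainTheorem3_general (isEmbeddingInvariant_cartesianPower_completeGraph k)
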